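/- Let $\mathcal P=\langle X\mid \mathcal R\rangle$ be a semigroup presentation and $w$ a word over $X$. An atomic diagram $(p,u=v,q)$ over $\mathcal P$, where $(u,v)\in\mathcal R\cup\mathcal R^{-1}$, consists of a single cell with top label $u$ and bottom label $v$, with a path labelled $p$ on its left and a path labelled $q$ on its right; its top path is labelled $puq$ and its bottom path $pvq$. A $(w,w')$-diagram over $\mathcal P$ is a (possibly empty) concatenation of atomic diagrams with top label $w$ and bottom label $w'$, considered up to isotopy of labelled plane graphs. Removing a dipole means cancelling two cells such that the bottom path of the first is the top path of the second and the top label of the first equals the bottom label of the second. A diagram without dipoles is called reduced. The diagram group $\mathcal D(\mathcal P,w)$ consists of the $(w,w)$-diagrams modulo removal of dipoles, with concatenation as the operation. For $g\in\mathcal D(\mathcal P,w)$ let $\#(g)$ be the number of cells of the reduced diagram representing $g$. The group $\mathcal D(\mathcal P,w)$ has property B if it is finitely generated and the functions $\#$ and $\ell$ are equivalent, where $\ell$ is the word length with respect to a finite generating set (any one); that is, there are constants $c_1,c_2>0$ with $\#(g)\le c_1\,\ell(g)$ and $\ell(g)\le c_2\,\#(g)$ for all $g$. **Theorem.** Let $\mathcal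 P=\langle x,a\mid x^3=x^2,\ ax=a\rangle$ and let $U=\mathcal D(\mathcal P,a)$ be the universal diagram group. Then $U$ has property B. More precisely, for $n\ge 0$ let $x_n\in U$ be the element represented by the $(a,a)$-diagram obtained from the atomic diagram $(a,x^2=x^3,x^n)$ by adding $n+2$ cells $a=ax$ on the top and $n+3$ cells $ax=a$ on the bottom. Then $x_0,x_1,x_2$ generate $U$, and every element of $U$ that is represented by an $(a,a)$-diagram with $N\ge 1$ cells (in particular, by a reduced one) has word length less than $5N$ with respect to the generators $x_0,x_1,x_2$. -/

import Mathlib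

universe u

/-- A semigroup presentation `⟨X ∣ R⟩`: a set of ordered pairs of nonempty words over `X` such that
`(u, v) ∈ R` implies `(v, u) ∉ R`. -/
structure SemigroupPresentation (X : Type u) where
  /-- the defining relations -/
  rels : Set (List X × List X)
  ne_nil : ∀ r ∈ rels, r.1 ≠ [] ∧ r.2 ≠ []
  asymm : ∀ s t : List X, (s, t) ∈ rels → (t, s) ∉ rels

/-- An atomic 2-path `(p, s = t, q)` with `(s, t) ∈ R ∪ R⁻¹`, i.e. an atomic diagram: one cell with
top label `s` and bottom label `t`, with `p` on its left and `q` on its right. -/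
@[ext]
structure AtomicTwoPath {X : Type u} (P : SemigroupPresentation X) where
  p : List X
  s : List X
  t : List X
  q : List X
  rel : (s, t) ∈ P.rels ∨ (t, s) ∈ P.rels

namespace AtomicTwoPath

variable {X : Type u} {P : SemigroupPresentation X}

/-- The label of the top path. -/
def top (e : AtomicTwoPath P) : List X := e.p ++ e.s ++ e.q

/-- The label of the bottom path. -/
def bot (e : AtomicTwoPath P) : List X := e.p ++ e.t ++ e.q

/-- The mirror image. -/
def mirror (e : AtomicTwoPath P) : AtomicTwoPath P := ⟨e.p, e.t, e.s, e.q, e.rel.symm⟩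

end AtomicTwoPath

/-- `IsTwoPath l w w'`: the atomic diagrams in the list `l` can be concatenated one after another,
the first top label being `w` and the last bottom label being `w'` (and `w = w'` if `l` is
empty). -/
def IsTwoPath {X : Type u} {P : SemigroupPresentation X} :
    List (AtomicTwoPath P) → List X → List X → Prop
  | [], w, w' => w = w'
  | e :: l, w, w' => w = e.top ∧ IsTwoPath l e.bot w'

theorem IsTwoPath.append {X : Type u} {P : SemigroupPresentation X}
    {l m : List (AtomicTwoPath P)} {w w' w'' : List X}
    (h : IsTwoPath l w w') (h' : IsTwoPath m w' w'') : IsTwoPath (l ++ m) w w'' := by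
  induction l generalizing w with
  | nil => cases h; exact h'
  | cons e l ih => exact ⟨h.1, ih h.2⟩

theorem IsTwoPath.mirror {X : Type u} {P : SemigroupPresentation X}
    {l : List (AtomicTwoPath P)} {w w' : List X} (h : IsTwoPath l w w') :
    IsTwoPath (l.map AtomicTwoPath.mirror).reverse w' w := by
  induction l generalizing w with
  | nil => exact Eq.symm h
  | cons e l ih =>
    rw [List.map_cons, List.reverse_cons]
    exact (ih h.2).append ⟨rfl, h.1.symm⟩

theorem IsTwoPath.of_append {X : Type u} {P : SemigroupPresentation X}
    {l m : List (AtomicTwoPath P)} {w w'' : List X} (h : IsTwoPath (l ++ m) w w'') :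
    ∃ w', IsTwoPath l w w' ∧ IsTwoPath m w' w'' := by
  induction l generalizing w with
  | nil => exact ⟨w, rfl, h⟩
  | cons e l ih =>
    obtain ⟨w', h1, h2⟩ := ih h.2
    exact ⟨w', ⟨h.1, h1⟩, h2⟩

/-- A concatenation of atomic diagrams (possibly none) with top label `w` and bottom
label `w'`. -/
structure TwoPath {X : Type u} (P : SemigroupPresentation X) (w w' : List X) where
  steps : List (AtomicTwoPath P)
  isTwoPath : IsTwoPath steps w w'

/-- The elementary isotopy.  In the word `p ++ s ++ q ++ s' ++ r` a cell `s = t` can be attached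
along `s` and a cell `s' = t'` along `s'`; since the two cells sit side by side, the order in which
they are attached is irrelevant for the plane graph that results.  Two concatenations of atomic
diagrams are isotopic as labelled plane graphs if and only if they are connected by a finite
sequence of such interchanges (performed in either direction). -/
def Interchange {X : Type u} {P : SemigroupPresentation X} (l l' : List (AtomicTwoPath P)) : Prop :=
  ∃ (L R : List (AtomicTwoPath P)) (p s t q s' t' r : List X)
    (h : (s, t) ∈ P.rels ∨ (t, s) ∈ P.rels) (h' : (s', t') ∈ P.rels ∨ (t', s') ∈ P.rels),
    l = L ++ [⟨p, s, t, q ++ s' ++ r, h⟩, ⟨p ++ t ++ q, s', t', r, h'⟩] ++ R ∧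
    l' = L ++ [⟨p ++ s ++ q, s', t', r, h'⟩, ⟨p, s, t, q ++ t' ++ r, h⟩] ++ R

/-- `(w, w')`-diagrams over `P`: concatenations of atomic diagrams up to isotopy.  (`Quot` divides
by the equivalence relation generated by the interchanges.) -/
def Diagram {X : Type u} (P : SemigroupPresentation X) (w w' : List X) : Type u :=
  Quot fun A B : TwoPath P w w' => Interchange A.steps B.steps

namespace Diagram

variable {X : Type u} {P : SemigroupPresentation X}

/-- The diagram given by a concatenation of atomic diagrams. -/
def mk {w w' : List X} (A : TwoPath P w w') : Diagram P w w' := Quot.mk _ A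

/-- The number of cells of a diagram. -/
def numCells {w w' : List X} : Diagram P w w' → ℕ :=
  Quot.lift (fun A => A.steps.length) (by
    rintro A B ⟨L, R, p, s, t, q, s', t', r, h, h', hA, hB⟩
    simp [hA, hB])

/-- The trivial diagram `ε(w)`. -/
def triv (P : SemigroupPresentation X) (w : List X) : Diagram P w w := mk ⟨[], rfl⟩

/-- The concatenation `Δ ∘ Δ'`. -/
def comp {w w' w'' : List X} : Diagram P w w' → Diagram P w' w'' → Diagram P w w'' :=
  Quot.map₂ (fun A B => ⟨A.steps ++ B.steps, A.isTwoPath.append B.isTwoPath⟩)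
    (by
      rintro A B B' ⟨L, R, p, s, t, q, s', t', r, h, h', hB, hB'⟩
      exact ⟨A.steps ++ L, R, p, s, t, q, s', t', r, h, h', by simp [hB], by simp [hB']⟩)
    (by
      rintro A A' B ⟨L, R, p, s, t, q, s', t', r, h, h', hA, hA'⟩
      exact ⟨L, R ++ B.steps, p, s, t, q, s', t', r, h, h', by simp [hA], by simp [hA']⟩)

/-- The mirror image `Δ⁻¹`. -/
def mirror {w w' : List X} : Diagram P w w' → Diagram P w' w :=
  Quot.lift (fun A => mk ⟨(A.steps.map AtomicTwoPath.mirror).reverse, A.isTwoPath.mirror⟩) (by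
    rintro A B ⟨L, R, p, s, t, q, s', t', r, h, h', hA, hB⟩
    refine (Quot.sound ?_).symm
    refine ⟨(R.map AtomicTwoPath.mirror).reverse, (L.map AtomicTwoPath.mirror).reverse,
      p, t, s, q, t', s', r, h.symm, h'.symm, ?_, ?_⟩
    · simp [hB, AtomicTwoPath.mirror]
    · simp [hA, AtomicTwoPath.mirror])

/-- `Δ'` is obtained from `Δ` by removing a dipole, i.e. a pair of cells `π', π''` such that the
bottom path of `π'` is the top path of `π''` and the top label of `π'` is the bottom label of
`π''`.  (Such cells are consecutive factors in a suitable decomposition of `Δ` into atomic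
diagrams.) -/
def RemoveDipole {w w' : List X} (Δ Δ' : Diagram P w w') : Prop :=
  ∃ (A B : TwoPath P w w') (L R : List (AtomicTwoPath P)) (e : AtomicTwoPath P),
    Δ = mk A ∧ Δ' = mk B ∧ A.steps = L ++ [e, e.mirror] ++ R ∧ B.steps = L ++ R

/-- A diagram is reduced if it has no dipoles. -/
def Reduced {w w' : List X} (Δ : Diagram P w w') : Prop :=
  ∀ Δ' : Diagram P w w', ¬ RemoveDipole Δ Δ'

theorem RemoveDipole.comp_left {w w' w'' : List X} (Γ : Diagram P w w')
    {Δ Δ' : Diagram P w' w''} (h : RemoveDipole Δ Δ') :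
    RemoveDipole (Γ.comp Δ) (Γ.comp Δ') := by
  obtain ⟨A, B, L, R, e, rfl, rfl, hA, hB⟩ := h
  induction Γ using Quot.ind with
  | mk C =>
    exact ⟨⟨C.steps ++ A.steps, C.isTwoPath.append A.isTwoPath⟩,
      ⟨C.steps ++ B.steps, C.isTwoPath.append B.isTwoPath⟩, C.steps ++ L, R, e, rfl, rfl,
      by simp [hA], by simp [hB]⟩

theorem RemoveDipole.comp_right {w w' w'' : List X} (Γ : Diagram P w' w'')
    {Δ Δ' : Diagram P w w'} (h : RemoveDipole Δ Δ') :
    RemoveDipole (Δ.comp Γ) (Δ'.comp Γ) := by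
  obtain ⟨A, B, L, R, e, rfl, rfl, hA, hB⟩ := h
  induction Γ using Quot.ind with
  | mk C =>
    exact ⟨⟨A.steps ++ C.steps, A.isTwoPath.append C.isTwoPath⟩,
      ⟨B.steps ++ C.steps, B.isTwoPath.append C.isTwoPath⟩, L, R ++ C.steps, e, rfl, rfl,
      by simp [hA], by simp [hB]⟩

theorem RemoveDipole.mirror {w w' : List X} {Δ Δ' : Diagram P w w'} (h : RemoveDipole Δ Δ') :
    RemoveDipole Δ.mirror Δ'.mirror := by
  obtain ⟨A, B, L, R, e, rfl, rfl, hA, hB⟩ := h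
  refine ⟨⟨_, A.isTwoPath.mirror⟩, ⟨_, B.isTwoPath.mirror⟩,
    (R.map AtomicTwoPath.mirror).reverse, (L.map AtomicTwoPath.mirror).reverse, e, rfl, rfl, ?_, ?_⟩
  · simp [hA, AtomicTwoPath.mirror]
  · simp [hB]

end Diagram

/-- The diagram group `𝒟(P, w)`: `(w, w)`-diagrams up to equivalence, i.e. up to the equivalence
relation generated by the removal of dipoles. -/
def DiagramGroup {X : Type u} (P : SemigroupPresentation X) (w : List X) : Type u :=
  Quot (Diagram.RemoveDipole (P := P) (w := w) (w' := w))

namespace DiagramGroup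

variable {X : Type u} {P : SemigroupPresentation X} {w : List X}

/-- The element represented by a diagram. -/
def mk (Δ : Diagram P w w) : DiagramGroup P w := Quot.mk _ Δ

theorem mirror_comp_self {w' : List X} (l : List (AtomicTwoPath P)) (h : IsTwoPath l w w') :
    mk (Diagram.mk ⟨(l.map AtomicTwoPath.mirror).reverse ++ l, h.mirror.append h⟩) =
      mk (Diagram.triv P w') := by
  induction l generalizing w with
  | nil => rfl
  | cons e l ih =>
    rw [← ih h.2]
    exact Quot.sound ⟨_, _, (l.map AtomicTwoPath.mirror).reverse, l, e.mirror, rfl, rfl,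
      by simp [AtomicTwoPath.mirror], rfl⟩

/-- The group operation is concatenation, the unit is the trivial diagram, inverses are mirror
images. -/
instance : Group (DiagramGroup P w) where
  mul := Quot.map₂ Diagram.comp (fun Γ _ _ h => h.comp_left Γ) (fun _ _ Γ h => h.comp_right Γ)
  one := mk (Diagram.triv P w)
  inv := Quot.map Diagram.mirror fun _ _ h => h.mirror
  mul_assoc := by
    rintro ⟨⟨A⟩⟩ ⟨⟨B⟩⟩ ⟨⟨C⟩⟩
    change mk (Diagram.mk ⟨(A.steps ++ B.steps) ++ C.steps, _⟩) =
      mk (Diagram.mk ⟨A.steps ++ (B.steps ++ C.steps), _⟩)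
    simp only [List.append_assoc]
  one_mul := by
    rintro ⟨⟨A⟩⟩
    rfl
  mul_one := by
    rintro ⟨⟨A⟩⟩
    change mk (Diagram.mk ⟨A.steps ++ [], _⟩) = mk (Diagram.mk ⟨A.steps, _⟩)
    simp only [List.append_nil]
  inv_mul_cancel := by
    rintro ⟨⟨A⟩⟩
    exact mirror_comp_self A.steps A.isTwoPath

/-- `#(g)`: the number of cells in the reduced diagram representing `g`. -/
noncomputable def numCells (g : DiagramGroup P w) : ℕ :=
  sInf {n | ∃ Δ : Diagram P w w, Δ.Reduced ∧ mk Δ = g ∧ Δ.numCells = n}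

/-- Every element is represented by a reduced diagram, and it can be reached without increasing the
number of cells. -/
theorem exists_reduced (Δ : Diagram P w w) :
    ∃ Δ' : Diagram P w w, Δ'.Reduced ∧ mk Δ' = mk Δ ∧ Δ'.numCells ≤ Δ.numCells := by
  induction hn : Δ.numCells using Nat.strong_induction_on generalizing Δ with
  | _ n ih =>
    by_cases hr : Δ.Reduced
    · exact ⟨Δ, hr, rfl, hn.le⟩
    · obtain ⟨Γ, hΓ⟩ : ∃ Γ, Diagram.RemoveDipole Δ Γ := by
        simpa [Diagram.Reduced] using hr
      have hlt : Γ.numCells < n := by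
        obtain ⟨A, B, L, R, e, rfl, rfl, hA, hB⟩ := hΓ
        rw [← hn]
        change B.steps.length < A.steps.length
        simp [hA, hB]
      obtain ⟨Δ', h1, h2, h3⟩ := ih _ hlt Γ rfl
      exact ⟨Δ', h1, h2.trans (Quot.sound hΓ).symm, h3.trans hlt.le⟩

end DiagramGroup

/-- `ℓ_S(g)`: the length of a shortest word over `S ∪ S⁻¹` that represents `g`. -/
noncomputable def wordLength {G : Type u} [Group G] (S : Set G) (g : G) : ℕ :=
  sInf {n | ∃ l : List G, (∀ y ∈ l, y ∈ S ∨ y⁻¹ ∈ S) ∧ l.prod = g ∧ l.length = n}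

/-- `f ⪯ g`: there is a constant `c > 0` with `f m ≤ c * g m` for all `m`. -/
def Dominated {M : Type u} (f g : M → ℝ) : Prop :=
  ∃ c : ℝ, 0 < c ∧ ∀ m, f m ≤ c * g m

/-- Property B of the diagram group `𝒟(P, w)`: it is finitely generated, and the functions
`g ↦ #(g)` and `g ↦ ℓ(g)` are equivalent, where `ℓ` is the word length with respect to any finite
generating set. -/
def HasPropertyB {X : Type u} (P : SemigroupPresentation X) (w : List X) : Prop :=
  Group.FG (DiagramGroup P w) ∧
  ∀ S : Set (DiagramGroup P w), S.Finite → Subgroup.closure S = ⊤ →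
    Dominated (fun g => (DiagramGroup.numCells g : ℝ)) (fun g => (wordLength S g : ℝ)) ∧
    Dominated (fun g => (wordLength S g : ℝ)) (fun g => (DiagramGroup.numCells g : ℝ))

/-- The alphabet `{x, a}`. -/
inductive XA : Type
  | x : XA
  | a : XA

/-- The semigroup presentation `⟨x, a ∣ x³ = x², ax = a⟩`. -/
def universalPresentation : SemigroupPresentation XA where
  rels := {([XA.x, XA.x, XA.x], [XA.x, XA.x]), ([XA.a, XA.x], [XA.a])}
  ne_nil := by
    rintro r (rfl | rfl) <;> simp
  asymm := by
    rintro s t (h | h) (h' | h') <;> simp_all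

/-- The universal diagram group `U = 𝒟(⟨x, a ∣ x³ = x², ax = a⟩, a)`. -/
abbrev UniversalDiagramGroup : Type := DiagramGroup universalPresentation [XA.a]

namespace UniversalDiagramGroup

/-- The atomic diagram `(1, a = ax, xⁱ)`. -/
def grow (i : ℕ) : AtomicTwoPath universalPresentation :=
  ⟨[], [XA.a], [XA.a, XA.x], List.replicate i XA.x, by simp [universalPresentation]⟩

/-- The atomic diagram `(a, x² = x³, xⁿ)`. -/
def core (n : ℕ) : AtomicTwoPath universalPresentation :=
  ⟨[XA.a], [XA.x, XA.x], [XA.x, XA.x, XA.x], List.replicate n XA.x,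
    by simp [universalPresentation]⟩

theorem isTwoPath_grow (k : ℕ) :
    IsTwoPath ((List.range k).map grow) [XA.a] (XA.a :: List.replicate k XA.x) := by
  induction k with
  | zero => rfl
  | succ k ih =>
    rw [List.range_succ, List.map_append]
    exact ih.append ⟨rfl, rfl⟩

theorem isTwoPath_core (n : ℕ) :
    IsTwoPath [core n] (XA.a :: List.replicate (n + 2) XA.x)
      (XA.a :: List.replicate (n + 3) XA.x) :=
  ⟨rfl, rfl⟩

/-- The `(a, a)`-diagram made of the cell `(a, x² = x³, xⁿ)` by adding `n + 2` cells `a = ax` on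
the top and `n + 3` cells `ax = a` on the bottom. -/
def genTwoPath (n : ℕ) : TwoPath universalPresentation [XA.a] [XA.a] where
  steps := (List.range (n + 2)).map grow ++ [core n] ++
    (((List.range (n + 3)).map grow).map AtomicTwoPath.mirror).reverse
  isTwoPath := ((isTwoPath_grow (n + 2)).append (isTwoPath_core n)).append
    (isTwoPath_grow (n + 3)).mirror

/-- The standard generator `xₙ` of `U`. -/
def gen (n : ℕ) : UniversalDiagramGroup := DiagramGroup.mk (Diagram.mk (genTwoPath n))

end UniversalDiagramGroup

/-! Every word reachable from `a` is some `axᵏ`. Padding with cells `a = ax` above and `ax = a`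
below turns `(axᵏ, axᵏ')`-diagrams into elements of `U`, multiplicatively. Cells `a = ax` then
contribute 1, and a cell `x² = x³` with `xʲ` on its right contributes `x_j`, whatever lies on its
left. So an element is the product of letters `x_j^{±1}` read along any order of attaching the cells
(`mk_eq_prod`).

Two cells side by side give `x_{n+2} x_0 = x_0 x_{n+3}` (`gen_mul_gen_zero`), so `x_j` is `x_2`
conjugated by `x_0^{j-2}` for `j ≥ 2`. A single letter may thus be expensive, but conjugating powers
of consecutive letters telescope to `x_0^{a-b}`, where `a` and `b` are the two values of `max(j-2,
0)`.

The order of the cells is chosen so that none is directly followed by one entirely to its right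
(`exists_isChain`). Then the length of the right context drops by at most 2 per step. Since it
begins and ends at 0, rises balance drops, and `N` cells cost at most `N + 4(N-1) = 5N - 4` letters
(`isWordOfLengthLE_prod`).

The reverse inequality of property B is subadditivity of the number of cells under concatenation. -/

/-! ### Ordering the cells of a diagram. -/

namespace AtomicTwoPath

variable {X : Type u} {P : SemigroupPresentation X}

theorem s_ne_nil (e : AtomicTwoPath P) : e.s ≠ [] := by
  rcases e.rel with h | h
  · exact (P.ne_nil _ h).1
  · exact (P.ne_nil _ h).2

theorem t_ne_nil (e : AtomicTwoPath P) : e.t ≠ [] := e.mirror.s_ne_nil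

/-- The cell of `f`, attached after `e`, is not entirely to the right of the cell of `e`. -/
def NotRight (e f : AtomicTwoPath P) : Prop := e.q.length < f.q.length + f.s.length

theorem exists_of_not_notRight {e f : AtomicTwoPath P} (h : e.bot = f.top) (hr : ¬ NotRight e f) :
    ∃ q, e.q = q ++ f.s ++ f.q ∧ f.p = e.p ++ e.t ++ q := by
  have hr : f.q.length + f.s.length ≤ e.q.length := not_lt.mp hr
  have h : (e.p ++ e.t) ++ e.q = f.p ++ (f.s ++ f.q) := by
    simpa [top, bot] using h
  rcases List.append_eq_append_iff.mp h with ⟨q, h1, h2⟩ | ⟨q, h1, h2⟩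
  · exact ⟨q, by simpa using h2, h1⟩
  -- The overlap `q` has length at most 0 by `hr`, so the two cells merely touch.
  · have h3 : q = [] := by
      have := congrArg List.length h2
      simp only [List.length_append] at this
      exact List.eq_nil_of_length_eq_zero (by omega)
    subst h3
    exact ⟨[], by simpa using h2.symm, by simpa using h1.symm⟩

end AtomicTwoPath

namespace Diagram

variable {X : Type u} {P : SemigroupPresentation X}

theorem mk_cons_congr {e : AtomicTwoPath P} {w w' : List X} (hw : w = e.top)
    {A B : TwoPath P e.bot w'} (h : mk A = mk B) :
    mk (⟨e :: A.steps, hw, A.isTwoPath⟩ : TwoPath P w w') =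
      mk ⟨e :: B.steps, hw, B.isTwoPath⟩ :=
  congrArg (comp (mk (⟨[e], hw, rfl⟩ : TwoPath P w e.bot))) h

/-- Attaching a step on top of a concatenation in which no cell is directly followed by one
entirely to its right, and restoring this condition by interchanges. -/
theorem exists_isChain_cons (l : List (AtomicTwoPath P)) (e : AtomicTwoPath P) {w w' : List X}
    (h : IsTwoPath (e :: l) w w') (hl : l.IsChain AtomicTwoPath.NotRight) :
    ∃ B : TwoPath P w w', mk ⟨e :: l, h⟩ = mk B ∧ B.steps.IsChain AtomicTwoPath.NotRight ∧
      ∀ f ∈ B.steps.head?, f = e ∨ ∃ g ∈ l.head?, f.q = g.q ∧ f.s = g.s := by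
  induction l generalizing e w with
  | nil => exact ⟨⟨[e], h⟩, rfl, by simp, by simp⟩
  | cons f l ih =>
    by_cases hr : AtomicTwoPath.NotRight e f
    · exact ⟨⟨e :: f :: l, h⟩, rfl, List.IsChain.cons_cons hr hl, by simp⟩
    · obtain ⟨p, s, t, q', he⟩ := e
      obtain ⟨p', s', t', r, hf⟩ := f
      obtain ⟨q, h1, h2⟩ := AtomicTwoPath.exists_of_not_notRight h.2.1 hr
      dsimp only at h1 h2
      subst h1 h2
      obtain ⟨hw, hef, hl'⟩ := h
      subst hw
      set f' : AtomicTwoPath P := ⟨p ++ s ++ q, s', t', r, hf⟩ with hf'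
      set e' : AtomicTwoPath P := ⟨p, s, t, q ++ t' ++ r, he⟩ with he'
      have htop : (⟨p, s, t, q ++ s' ++ r, he⟩ : AtomicTwoPath P).top = f'.top := by
        simp [AtomicTwoPath.top, hf']
      have hmid : f'.bot = e'.top := by simp [AtomicTwoPath.top, AtomicTwoPath.bot, hf', he']
      have hbot : (⟨p ++ t ++ q, s', t', r, hf⟩ : AtomicTwoPath P).bot = e'.bot := by
        simp [AtomicTwoPath.bot, he']
      obtain ⟨B, hB, hBc, hBh⟩ := ih e' (w := f'.bot) ⟨hmid, hbot ▸ hl'⟩ hl.of_cons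
      refine ⟨⟨f' :: B.steps, htop, B.isTwoPath⟩, ?_, ?_, ?_⟩
      · refine Eq.trans (b := mk ⟨f' :: e' :: l, htop, hmid, hbot ▸ hl'⟩) (Quot.sound ?_)
          (mk_cons_congr htop (A := ⟨e' :: l, hmid, hbot ▸ hl'⟩) hB)
        exact ⟨[], l, p, s, t, q, s', t', r, he, hf, rfl, rfl⟩
      -- Only the right context of the first cell and the right context and top label of the second
      -- matter for `NotRight`. Interchanges preserve these data for the cell that moves up, so its
      -- old relation to the next cell survives. If `e'` comes next instead, nonemptiness of its top
      -- label suffices.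
      · refine List.isChain_cons.mpr ⟨fun g hg => ?_, hBc⟩
        rcases hBh g hg with rfl | ⟨k, hk, hkq, hks⟩
        · have := List.length_pos_iff.mpr e'.s_ne_nil
          simp only [AtomicTwoPath.NotRight, hf', he', List.length_append] at this ⊢
          omega
        · have := (List.isChain_cons.mp hl).1 k hk
          simpa only [AtomicTwoPath.NotRight, hkq, hks] using this
      · intro g hg
        obtain rfl : f' = g := by simpa using hg
        exact Or.inr ⟨_, rfl, rfl, rfl⟩

/-- Every diagram is a concatenation of atomic diagrams in which no cell is directly followed by a
cell entirely to its right. -/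
theorem exists_isChain {w w' : List X} (Δ : Diagram P w w') :
    ∃ B : TwoPath P w w', mk B = Δ ∧ B.steps.IsChain AtomicTwoPath.NotRight := by
  suffices H : ∀ (l : List (AtomicTwoPath P)) (w : List X) (h : IsTwoPath l w w'),
      ∃ B : TwoPath P w w', mk B = mk ⟨l, h⟩ ∧ B.steps.IsChain AtomicTwoPath.NotRight by
    obtain ⟨⟨l, h⟩⟩ := Δ
    exact H l w h
  intro l w h
  induction l generalizing w with
  | nil => exact ⟨⟨[], h⟩, rfl, List.IsChain.nil⟩
  | cons e l ih =>
    obtain ⟨rfl, hl⟩ := h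
    obtain ⟨A, hA, hAc⟩ := ih _ hl
    obtain ⟨B, hB, hBc, -⟩ := exists_isChain_cons A.steps e ⟨rfl, A.isTwoPath⟩ hAc
    exact ⟨B, hB.symm.trans (mk_cons_congr rfl hA), hBc⟩

end Diagram

/-! ### Products, inverses and cancellation on representatives. -/

namespace DiagramGroup

variable {X : Type u} {P : SemigroupPresentation X} {w : List X}

theorem mk_eq_one_of_numCells_eq_zero (Δ : Diagram P w w) (h : Δ.numCells = 0) :
    mk Δ = 1 := by
  obtain ⟨⟨l, hl⟩⟩ := Δ
  obtain rfl : l = [] := List.eq_nil_of_length_eq_zero h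
  rfl

theorem mk_mul_mk (A B : TwoPath P w w) :
    mk (Diagram.mk A) * mk (Diagram.mk B) =
      mk (Diagram.mk ⟨A.steps ++ B.steps, A.isTwoPath.append B.isTwoPath⟩) := rfl

theorem mk_inv (A : TwoPath P w w) :
    (mk (Diagram.mk A))⁻¹ =
      mk (Diagram.mk ⟨(A.steps.map AtomicTwoPath.mirror).reverse, A.isTwoPath.mirror⟩) := rfl

theorem mk_remove_mirror (L m R : List (AtomicTwoPath P))
    (h : IsTwoPath (L ++ (m.map AtomicTwoPath.mirror).reverse ++ m ++ R) w w)
    (h' : IsTwoPath (L ++ R) w w) :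
    mk (Diagram.mk ⟨_, h⟩) = mk (Diagram.mk ⟨_, h'⟩) := by
  induction m generalizing L R with
  | nil => simp
  | cons e m ih =>
    obtain ⟨w₁, h₁, h₂⟩ := h.of_append
    obtain ⟨w₂, h₃, h₄⟩ := h₁.of_append
    obtain ⟨w₃, h₅, h₆⟩ := h₃.of_append
    rw [List.map_cons, List.reverse_cons] at h₆
    obtain ⟨w₄, h₇, h₈⟩ := h₆.of_append
    obtain rfl : w₄ = e.bot := h₈.1
    have h₉ := ((h₅.append h₇).append h₄.2).append h₂
    rw [← ih L R h₉ h']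
    exact Quot.sound ⟨⟨_, h⟩, ⟨_, h₉⟩, L ++ (m.map AtomicTwoPath.mirror).reverse, m ++ R, e.mirror,
      rfl, rfl, by simp [AtomicTwoPath.mirror], by simp⟩

end DiagramGroup

/-! ### Reading an element of `U` off a sequence of cells. -/

namespace UniversalDiagramGroup

/-- The word `axᵏ`. -/
abbrev axWord (k : ℕ) : List XA := XA.a :: List.replicate k XA.x

/-- The atomic diagram `(axⁱ, x² = x³, xʲ)`. -/
def coreAt (i j : ℕ) : AtomicTwoPath universalPresentation :=
  ⟨XA.a :: List.replicate i XA.x, [XA.x, XA.x], [XA.x, XA.x, XA.x], List.replicate j XA.x,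
    by simp [universalPresentation]⟩

theorem top_coreAt (i j : ℕ) : (coreAt i j).top = axWord (i + j + 2) := by
  have : i + j + 2 = i + (2 + j) := by omega
  simp only [this, axWord, List.replicate_add]
  simp [coreAt, AtomicTwoPath.top, List.replicate_succ]

theorem bot_coreAt (i j : ℕ) : (coreAt i j).bot = axWord (i + j + 2 + 1) := by
  have : i + j + 2 + 1 = i + (3 + j) := by omega
  simp only [this, axWord, List.replicate_add]
  simp [coreAt, AtomicTwoPath.bot, List.replicate_succ]

/-- The only `a` is the first letter, so a relation involving `a` applies at the left end and a
relation in `x` applies strictly after it. -/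
theorem eq_of_top_eq_axWord {e : AtomicTwoPath universalPresentation} {k : ℕ}
    (h : e.top = axWord k) :
    e = grow k ∨ (∃ m, k = m + 1 ∧ e = (grow m).mirror) ∨
      (∃ i j, k = i + j + 2 ∧ e = coreAt i j) ∨
      ∃ i j, k = i + j + 3 ∧ e = (coreAt i j).mirror := by
  have hx : ∀ {p q : List XA} {n : ℕ}, p ++ List.replicate n XA.x ++ q = axWord k → n ≠ 0 →
      ∃ i j, k = i + j + n ∧ p = XA.a :: List.replicate i XA.x ∧ q = List.replicate j XA.x := by
    intro p q n h hn
    rcases p with _ | ⟨c, p⟩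
    · obtain ⟨n, rfl⟩ := Nat.exists_eq_succ_of_ne_zero hn
      simp [List.replicate_succ] at h
    · simp only [axWord, List.cons_append, List.cons.injEq, List.append_eq_replicate_iff] at h
      obtain ⟨rfl, h1, ⟨-, h2, -⟩, h3⟩ := h
      refine ⟨p.length, q.length, ?_, by rw [← h2], h3⟩
      simp at h1
      omega
  have ha : ∀ {p q : List XA}, p ++ XA.a :: q = axWord k → p = [] ∧ q = List.replicate k XA.x := by
    intro p q h
    rcases p with _ | ⟨c, p⟩
    · simpa using h
    · simp only [axWord, List.cons_append, List.cons.injEq, List.append_eq_replicate_iff] at h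
      have := h.2.2.2
      simp [List.replicate_succ] at this
  obtain ⟨p, s, t, q, hr⟩ := e
  simp only [AtomicTwoPath.top] at h
  rcases id hr with (hr' | hr') | (hr' | hr')
  · obtain ⟨rfl, rfl⟩ := Prod.mk.inj hr'
    obtain ⟨i, j, hk, rfl, rfl⟩ := hx (n := 3) h (by omega)
    exact Or.inr (Or.inr (Or.inr ⟨i, j, hk, rfl⟩))
  · obtain ⟨rfl, rfl⟩ := Prod.mk.inj hr'
    obtain ⟨rfl, h2⟩ := ha (q := XA.x :: q) (by simpa using h)
    rcases k with _ | k
    · simp at h2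
    · rw [List.replicate_succ, List.cons.injEq] at h2
      obtain ⟨-, rfl⟩ := h2
      exact Or.inr (Or.inl ⟨k, rfl, rfl⟩)
  · obtain ⟨rfl, rfl⟩ := Prod.mk.inj hr'
    obtain ⟨i, j, hk, rfl, rfl⟩ := hx (n := 2) h (by omega)
    exact Or.inr (Or.inr (Or.inl ⟨i, j, hk, rfl⟩))
  · obtain ⟨rfl, rfl⟩ := Prod.mk.inj hr'
    obtain ⟨rfl, rfl⟩ := ha (q := q) (by simpa using h)
    exact Or.inl rfl

/-- The concatenation of the cells `a = ax` leading from `a` to `axᵏ`. -/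
abbrev growth (k : ℕ) : List (AtomicTwoPath universalPresentation) := (List.range k).map grow

/-- The concatenation of the cells `ax = a` leading from `axᵏ` to `a`. -/
abbrev shrinkage (k : ℕ) : List (AtomicTwoPath universalPresentation) :=
  ((growth k).map AtomicTwoPath.mirror).reverse

theorem isTwoPath_close {l : List (AtomicTwoPath universalPresentation)} {k k' : ℕ}
    (h : IsTwoPath l (axWord k) (axWord k')) :
    IsTwoPath (growth k ++ l ++ shrinkage k') [XA.a] [XA.a] :=
  ((isTwoPath_grow k).append h).append (isTwoPath_grow k').mirror

/-- The element of `U` given by an `(axᵏ, axᵏ')`-diagram after adding cells `a = ax` on the top and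
cells `ax = a` on the bottom. -/
def close {k k' : ℕ} (A : TwoPath universalPresentation (axWord k) (axWord k')) :
    UniversalDiagramGroup :=
  DiagramGroup.mk (Diagram.mk ⟨growth k ++ A.steps ++ shrinkage k', isTwoPath_close A.isTwoPath⟩)

theorem close_congr {k k' : ℕ} {A B : TwoPath universalPresentation (axWord k) (axWord k')}
    (h : Diagram.mk A = Diagram.mk B) : close A = close B :=
  congrArg (fun Γ => DiagramGroup.mk
    (((Diagram.mk ⟨growth k, isTwoPath_grow k⟩).comp Γ).comp
      (Diagram.mk ⟨shrinkage k', (isTwoPath_grow k').mirror⟩))) h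

theorem close_nil {k : ℕ} (h : IsTwoPath ([] : List (AtomicTwoPath universalPresentation))
    (axWord k) (axWord k)) : close ⟨[], h⟩ = 1 := by
  rw [← DiagramGroup.mk_eq_one_of_numCells_eq_zero (Diagram.triv _ _) rfl,
    ← DiagramGroup.mirror_comp_self (shrinkage k) (isTwoPath_grow k).mirror]
  simp only [close, List.append_nil, List.map_reverse, List.reverse_reverse, List.map_map]
  congr

/-- The padding cells at the intermediate word `axᵏ²` cancel as dipoles, which makes `close`
multiplicative. -/
theorem close_cons {k₁ k₂ k₃ : ℕ} {e : AtomicTwoPath universalPresentation}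
    {l : List (AtomicTwoPath universalPresentation)}
    (he : IsTwoPath [e] (axWord k₁) (axWord k₂)) (hl : IsTwoPath l (axWord k₂) (axWord k₃))
    (h : IsTwoPath (e :: l) (axWord k₁) (axWord k₃)) :
    close ⟨e :: l, h⟩ = close ⟨[e], he⟩ * close ⟨l, hl⟩ := by
  have key := DiagramGroup.mk_remove_mirror (growth k₁ ++ [e]) (growth k₂) (l ++ shrinkage k₃)
    (w := [XA.a]) (by
      simpa only [List.append_assoc] using (isTwoPath_close he).append (isTwoPath_close hl))
    (by simpa using isTwoPath_close h)
  simp only [close, DiagramGroup.mk_mul_mk]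
  simpa only [List.append_assoc, List.cons_append, List.nil_append] using key.symm

theorem close_mirror {k k' : ℕ} (A : TwoPath universalPresentation (axWord k) (axWord k')) :
    close ⟨_, A.isTwoPath.mirror⟩ = (close A)⁻¹ := by
  have hm : ∀ l : List (AtomicTwoPath universalPresentation),
    (l.map AtomicTwoPath.mirror).map AtomicTwoPath.mirror = l := fun l => by
      rw [List.map_map]; exact List.map_id l
  simp only [close, DiagramGroup.mk_inv, List.map_append, List.map_reverse, hm,
    List.reverse_append, List.reverse_reverse, List.append_assoc]

theorem growth_succ (k : ℕ) : growth (k + 1) = growth k ++ [grow k] := by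
  simp [growth, List.range_succ]

theorem isTwoPath_singleton_grow (k : ℕ) :
    IsTwoPath [grow k] (axWord k) (axWord (k + 1)) := ⟨rfl, rfl⟩

theorem isTwoPath_singleton_coreAt (i j : ℕ) :
    IsTwoPath [coreAt i j] (axWord (i + j + 2)) (axWord (i + j + 2 + 1)) :=
  ⟨(top_coreAt i j).symm, bot_coreAt i j⟩

theorem close_grow (k : ℕ) : close ⟨[grow k], isTwoPath_singleton_grow k⟩ = 1 := by
  rw [← close_nil (k := k + 1) rfl]
  simp only [close, growth_succ, List.append_nil]

/-- A cell `a = ax` at the left end commutes with a cell to its right and has value 1, so letters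
between `a` and the cell can be removed one at a time. -/
theorem close_coreAt {i j k k' : ℕ} (h : IsTwoPath [coreAt i j] (axWord k) (axWord k')) :
    close ⟨[coreAt i j], h⟩ = gen j := by
  have hk : k = i + j + 2 := by
    simpa using congrArg List.length (h.1.trans (top_coreAt i j))
  have hk' : k' = i + j + 3 := by
    simpa using congrArg List.length (h.2.symm.trans (bot_coreAt i j))
  induction i generalizing k k' with
  | zero =>
    obtain rfl : k = j + 2 := by omega
    obtain rfl : k' = j + 3 := by omega
    rfl
  | succ i ih =>
    obtain rfl : k = i + j + 2 + 1 := by omega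
    obtain rfl : k' = i + j + 2 + 1 + 1 := by omega
    have hA := (isTwoPath_singleton_grow (i + j + 2)).append h
    have hB := (isTwoPath_singleton_coreAt i j).append (isTwoPath_singleton_grow (i + j + 2 + 1))
    have hAB : close ⟨_, hA⟩ = close ⟨_, hB⟩ := by
      refine close_congr (Quot.sound ⟨[], [], [], [XA.a], [XA.a, XA.x], List.replicate i XA.x,
        [XA.x, XA.x], [XA.x, XA.x, XA.x], List.replicate j XA.x, ?_, ?_, ?_, ?_⟩)
      · simp [universalPresentation]
      · simp [universalPresentation]
      · have : i + j + 2 = i + (2 + j) := by omega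
        simp only [grow, coreAt, this, List.replicate_add]
        simp [List.replicate_succ]
        exact List.replicate_succ'.symm
      · have : i + j + 2 + 1 = i + (3 + j) := by omega
        simp only [grow, coreAt, this, List.replicate_add]
        simp [List.replicate_succ]
    have hA' := close_cons (isTwoPath_singleton_grow _) h hA
    have hB' := close_cons (isTwoPath_singleton_coreAt i j) (isTwoPath_singleton_grow _) hB
    rw [close_grow, one_mul] at hA'
    rw [close_grow, mul_one, ih _ rfl rfl] at hB'
    exact hA'.symm.trans (hAB.trans hB')

/-- The contribution of a single step to the element given by a concatenation of atomic
diagrams. -/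
def stepValue (e : AtomicTwoPath universalPresentation) : UniversalDiagramGroup :=
  match e.p, e.s with
  | [], _ => 1
  | _ :: _, [_, _] => gen e.q.length
  | _ :: _, _ => (gen e.q.length)⁻¹

theorem stepValue_coreAt (i j : ℕ) : stepValue (coreAt i j) = gen j := by
  simp [stepValue, coreAt]

theorem stepValue_mirror_coreAt (i j : ℕ) : stepValue (coreAt i j).mirror = (gen j)⁻¹ := by
  simp [stepValue, coreAt, AtomicTwoPath.mirror]

theorem close_eq_prod {k k' : ℕ} (A : TwoPath universalPresentation (axWord k) (axWord k')) :
    close A = (A.steps.map stepValue).prod := by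
  obtain ⟨l, h⟩ := A
  induction l generalizing k with
  | nil =>
    have hk : k = k' := by simpa [IsTwoPath] using h
    subst hk
    exact close_nil h
  | cons e l ih =>
    have step : ∀ {m : ℕ} (he : IsTwoPath [e] (axWord k) (axWord m)),
        close ⟨[e], he⟩ = stepValue e → close ⟨e :: l, h⟩ = ((e :: l).map stepValue).prod := by
      intro m he hv
      have hl : IsTwoPath l (axWord m) (axWord k') := he.2 ▸ h.2
      rw [close_cons he hl h, hv, ih hl, List.map_cons, List.prod_cons]
    rcases eq_of_top_eq_axWord h.1.symm with rfl | ⟨m, rfl, rfl⟩ | ⟨i, j, rfl, rfl⟩ | ⟨i, j, rfl, rfl⟩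
    · exact step (isTwoPath_singleton_grow k) (close_grow k)
    · refine step (isTwoPath_singleton_grow m).mirror ?_
      exact (close_mirror ⟨_, isTwoPath_singleton_grow m⟩).trans (by rw [close_grow]; exact inv_one)
    · exact step (isTwoPath_singleton_coreAt i j)
        ((close_coreAt _).trans (stepValue_coreAt i j).symm)
    · refine step (isTwoPath_singleton_coreAt i j).mirror ?_
      exact (close_mirror ⟨_, isTwoPath_singleton_coreAt i j⟩).trans
        (by rw [close_coreAt, stepValue_mirror_coreAt])

theorem mk_eq_prod (A : TwoPath universalPresentation [XA.a] [XA.a]) :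
    DiagramGroup.mk (Diagram.mk A) = (A.steps.map stepValue).prod := by
  rw [← close_eq_prod (k := 0) (k' := 0) A]
  change _ = DiagramGroup.mk (Diagram.mk ⟨A.steps ++ [], _⟩)
  simp only [List.append_nil]

/-- In `ax²xⁿx²` both squares are expanded, in either order. Expanding the right one first lengthens
the right context of the left one by one. -/
theorem gen_mul_gen_zero (n : ℕ) : gen (n + 2) * gen 0 = gen 0 * gen (n + 3) := by
  have h₁ := isTwoPath_singleton_coreAt 0 (n + 2)
  have h₂ := isTwoPath_singleton_coreAt (n + 3) 0
  have h₃ := isTwoPath_singleton_coreAt (n + 2) 0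
  have h₄ := isTwoPath_singleton_coreAt 0 (n + 3)
  have e₁ : 0 + (n + 2) + 2 = n + 4 := by omega
  have e₂ : n + 3 + 0 + 2 = n + 5 := by omega
  have e₃ : n + 2 + 0 + 2 = n + 4 := by omega
  have e₄ : 0 + (n + 3) + 2 = n + 5 := by omega
  simp only [e₁, e₂, e₃, e₄] at h₁ h₂ h₃ h₄
  have h := close_congr (Quot.sound (r := fun A B : TwoPath universalPresentation _ _ =>
      Interchange A.steps B.steps) (a := ⟨_, h₁.append h₂⟩) (b := ⟨_, h₃.append h₄⟩)
    ⟨[], [], [XA.a], [XA.x, XA.x], [XA.x, XA.x, XA.x], List.replicate n XA.x,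
      [XA.x, XA.x], [XA.x, XA.x, XA.x], [], by simp [universalPresentation],
      by simp [universalPresentation], ?_, ?_⟩)
  · simpa [close_eq_prod, stepValue_coreAt] using h
  · have := List.replicate_append_replicate (n := n) (m := 2) (a := XA.x)
    simp_all [coreAt, List.replicate_succ]
  · have := List.replicate_append_replicate (n := n) (m := 3) (a := XA.x)
    simp_all [coreAt, List.replicate_succ]

end UniversalDiagramGroup

/-! ### Word length in an arbitrary group. -/

section WordLength

variable {G : Type u} [Group G] {S : Set G}

/-- `g` is a product of at most `n` elements of `S ∪ S⁻¹`. -/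
def IsWordOfLengthLE (S : Set G) (n : ℕ) (g : G) : Prop :=
  ∃ l : List G, (∀ y ∈ l, y ∈ S ∨ y⁻¹ ∈ S) ∧ l.prod = g ∧ l.length ≤ n

namespace IsWordOfLengthLE

theorem one (n : ℕ) : IsWordOfLengthLE S n 1 := ⟨[], by simp, rfl, Nat.zero_le n⟩

theorem of_mem {g : G} (h : g ∈ S) : IsWordOfLengthLE S 1 g :=
  ⟨[g], by simp [h], by simp, le_rfl⟩

theorem mono {m n : ℕ} {g : G} (h : IsWordOfLengthLE S m g) (hmn : m ≤ n) :
    IsWordOfLengthLE S n g := by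
  obtain ⟨l, h1, h2, h3⟩ := h
  exact ⟨l, h1, h2, h3.trans hmn⟩

theorem mul {m n : ℕ} {g h : G} (hg : IsWordOfLengthLE S m g) (hh : IsWordOfLengthLE S n h) :
    IsWordOfLengthLE S (m + n) (g * h) := by
  obtain ⟨l, h1, h2, h3⟩ := hg
  obtain ⟨l', h1', h2', h3'⟩ := hh
  refine ⟨l ++ l', fun y hy => ?_, by simp [h2, h2'], by simp only [List.length_append]; omega⟩
  exact (List.mem_append.mp hy).elim (h1 y) (h1' y)

theorem inv {n : ℕ} {g : G} (hg : IsWordOfLengthLE S n g) : IsWordOfLengthLE S n g⁻¹ := by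
  obtain ⟨l, h1, h2, h3⟩ := hg
  refine ⟨(l.map (·⁻¹)).reverse, fun y hy => ?_, by rw [← h2, List.prod_inv_reverse], by simpa⟩
  simp only [List.mem_reverse, List.mem_map] at hy
  obtain ⟨z, hz, rfl⟩ := hy
  simpa using (h1 z hz).symm

theorem pow {n : ℕ} {g : G} (hg : IsWordOfLengthLE S n g) (k : ℕ) :
    IsWordOfLengthLE S (k * n) (g ^ k) := by
  induction k with
  | zero => simpa using one _
  | succ k ih =>
    rw [pow_succ, Nat.succ_mul]
    exact ih.mul hg

theorem zpow {n : ℕ} {g : G} (hg : IsWordOfLengthLE S n g) (k : ℤ) :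
    IsWordOfLengthLE S (k.natAbs * n) (g ^ k) := by
  obtain ⟨m, rfl | rfl⟩ := k.eq_nat_or_neg
  · simpa using hg.pow m
  · simpa using (hg.pow m).inv

theorem wordLength_le {n : ℕ} {g : G} (hg : IsWordOfLengthLE S n g) : wordLength S g ≤ n := by
  obtain ⟨l, h1, h2, h3⟩ := hg
  exact le_trans (Nat.sInf_le ⟨l, h1, h2, rfl⟩) h3

theorem mem_closure {n : ℕ} {g : G} (hg : IsWordOfLengthLE S n g) : g ∈ Subgroup.closure S := by
  obtain ⟨l, h1, rfl, -⟩ := hg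
  refine Subgroup.list_prod_mem _ fun y hy => ?_
  rcases h1 y hy with h | h
  · exact Subgroup.subset_closure h
  · exact inv_mem_iff.mp (Subgroup.subset_closure h)

theorem of_mem_closure {g : G} (hg : g ∈ Subgroup.closure S) :
    IsWordOfLengthLE S (wordLength S g) g := by
  -- Nonemptiness excludes the default value 0 of `sInf`, so the infimum is attained by a word.
  have hne : {n | ∃ l : List G, (∀ y ∈ l, y ∈ S ∨ y⁻¹ ∈ S) ∧ l.prod = g ∧ l.length = n}.Nonempty := by
    rw [← Subgroup.mem_toSubmonoid, Subgroup.closure_toSubmonoid] at hg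
    obtain ⟨l, h1, h2⟩ := Submonoid.exists_list_of_mem_closure hg
    exact ⟨_, l, h1, h2, rfl⟩
  obtain ⟨l, h1, h2, h3⟩ := Nat.sInf_mem hne
  exact ⟨l, h1, h2, h3.le⟩

/-- Words over one set are rewritten as words over another one, each letter being replaced by a word
of bounded length. -/
theorem trans {T : Set G} {n C : ℕ} {g : G} (hg : IsWordOfLengthLE S n g)
    (hST : ∀ y ∈ S, IsWordOfLengthLE T C y) : IsWordOfLengthLE T (C * n) g := by
  obtain ⟨l, h1, rfl, h3⟩ := hg
  refine mono ?_ (Nat.mul_le_mul_left C h3)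
  clear h3
  induction l with
  | nil => exact one _
  | cons y l ih =>
    have hy : IsWordOfLengthLE T C y := by
      rcases h1 y (by simp) with h | h
      · exact hST y h
      · simpa using (hST _ h).inv
    rw [List.prod_cons, List.length_cons, Nat.mul_succ, Nat.add_comm]
    exact hy.mul (ih fun z hz => h1 z (List.mem_cons_of_mem y hz))

end IsWordOfLengthLE

end WordLength

/-! ### Subadditivity of the number of cells. -/

namespace DiagramGroup

variable {X : Type u} {P : SemigroupPresentation X} {w : List X}

theorem numCells_mk_le (Δ : Diagram P w w) : numCells (mk Δ) ≤ Δ.numCells := by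
  obtain ⟨Δ', h1, h2, h3⟩ := exists_reduced Δ
  exact le_trans (Nat.sInf_le ⟨Δ', h1, h2, rfl⟩) h3

theorem exists_numCells_eq (g : DiagramGroup P w) :
    ∃ Δ : Diagram P w w, mk Δ = g ∧ Δ.numCells = numCells g := by
  have hne : {n | ∃ Δ : Diagram P w w, Δ.Reduced ∧ mk Δ = g ∧ Δ.numCells = n}.Nonempty := by
    obtain ⟨Δ⟩ := g
    obtain ⟨Δ', h1, h2, -⟩ := exists_reduced Δ
    exact ⟨_, Δ', h1, h2, rfl⟩
  obtain ⟨Δ, -, h2, h3⟩ := Nat.sInf_mem hne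
  exact ⟨Δ, h2, h3⟩

theorem numCells_one : numCells (1 : DiagramGroup P w) = 0 :=
  Nat.le_zero.mp (numCells_mk_le (Diagram.triv P w))

theorem numCells_mul_le (g h : DiagramGroup P w) :
    numCells (g * h) ≤ numCells g + numCells h := by
  obtain ⟨⟨A⟩, hA, hA'⟩ := exists_numCells_eq g
  obtain ⟨⟨B⟩, hB, hB'⟩ := exists_numCells_eq h
  rw [← hA', ← hB', ← hA, ← hB]
  refine (numCells_mk_le _).trans (le_of_eq ?_)
  exact List.length_append

theorem numCells_inv_le (g : DiagramGroup P w) : numCells g⁻¹ ≤ numCells g := by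
  obtain ⟨⟨A⟩, hA, hA'⟩ := exists_numCells_eq g
  rw [← hA', ← hA]
  refine (numCells_mk_le _).trans (le_of_eq ?_)
  exact (List.length_reverse).trans (List.length_map _)

theorem numCells_le_of_isWordOfLengthLE {S : Set (DiagramGroup P w)} {C n : ℕ}
    (hC : ∀ y ∈ S, numCells y ≤ C) {g : DiagramGroup P w} (hg : IsWordOfLengthLE S n g) :
    numCells g ≤ C * n := by
  obtain ⟨l, h1, rfl, h3⟩ := hg
  refine le_trans ?_ (Nat.mul_le_mul_left C h3)
  clear h3
  induction l with
  | nil => simp [numCells_one]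
  | cons y l ih =>
    have hy : numCells y ≤ C := by
      rcases h1 y (by simp) with h | h
      · exact hC y h
      · simpa using (numCells_inv_le y⁻¹).trans (hC _ h)
    rw [List.prod_cons, List.length_cons, Nat.mul_succ, Nat.add_comm]
    exact (numCells_mul_le _ _).trans
      (Nat.add_le_add hy (ih fun z hz => h1 z (List.mem_cons_of_mem y hz)))

end DiagramGroup

/-! ### The linear bound on word length and property B. -/

namespace UniversalDiagramGroup

/-- The generators `x₀, x₁, x₂`. -/
abbrev gens : Set UniversalDiagramGroup := {gen 0, gen 1, gen 2}

theorem gen_add_two (n : ℕ) : gen (n + 2) = (gen 0)⁻¹ ^ n * gen 2 * gen 0 ^ n := by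
  induction n with
  | zero => simp
  | succ n ih =>
    have h : gen (n + 3) = (gen 0)⁻¹ * gen (n + 2) * gen 0 := by
      rw [mul_assoc, gen_mul_gen_zero, inv_mul_cancel_left]
    rw [show n + 1 + 2 = n + 3 from rfl, h, ih, pow_succ', pow_succ]
    simp only [mul_assoc]

/-- Truncated subtraction makes the conjugation trivial for `j = 0, 1`, so all indices are treated
uniformly. -/
theorem conj_gen (j : ℕ) :
    IsWordOfLengthLE gens 1 (gen 0 ^ (j - 2) * gen j * (gen 0 ^ (j - 2))⁻¹) := by
  match j with
  | 0 => simpa using IsWordOfLengthLE.of_mem (S := gens) (g := gen 0) (by simp)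
  | 1 => simpa using IsWordOfLengthLE.of_mem (S := gens) (g := gen 1) (by simp)
  | n + 2 =>
    have : gen 0 ^ (n + 2 - 2) * gen (n + 2) * (gen 0 ^ (n + 2 - 2))⁻¹ = gen 2 := by
      rw [gen_add_two, Nat.add_sub_cancel, inv_pow]
      group
    rw [this]
    exact IsWordOfLengthLE.of_mem (by simp)

theorem conj_stepValue (e : AtomicTwoPath universalPresentation) :
    IsWordOfLengthLE gens 1
      (gen 0 ^ (e.q.length - 2) * stepValue e * (gen 0 ^ (e.q.length - 2))⁻¹) := by
  unfold stepValue
  split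
  · simpa using IsWordOfLengthLE.one 1
  · exact conj_gen _
  · simpa [mul_assoc] using (conj_gen e.q.length).inv

theorem length_s_le (e : AtomicTwoPath universalPresentation) : e.s.length ≤ 3 := by
  obtain ⟨p, s, t, q, (h | h) | (h | h)⟩ := e <;>
  · obtain ⟨rfl, rfl⟩ := Prod.mk.inj h
    simp

/-- The prefix `gen 0 ^ (e.q.length - 2)` is what remains after telescoping. Its exponent is also
added to `n` as a potential: a rise is paid for by the potential of the next cell, and a drop, at
most 2, is charged twice. Each further cell thus costs at most 5. -/
theorem isWordOfLengthLE_prod (l : List (AtomicTwoPath universalPresentation))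
    (e : AtomicTwoPath universalPresentation) (h : (e :: l).IsChain AtomicTwoPath.NotRight)
    (hlast : ((e :: l).getLast (by simp)).q = []) :
    ∃ n, n + (e.q.length - 2) ≤ 5 * l.length + 1 ∧
      IsWordOfLengthLE gens n (gen 0 ^ (e.q.length - 2) * ((e :: l).map stepValue).prod) := by
  have h₀ : IsWordOfLengthLE gens 1 (gen 0) := IsWordOfLengthLE.of_mem (by simp)
  induction l generalizing e with
  | nil =>
    have hq : e.q = [] := hlast
    exact ⟨1, by simp [hq], by simpa [hq] using conj_stepValue e⟩
  | cons f l ih =>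
    obtain ⟨n, hn, hw⟩ := ih f h.of_cons (by simpa using hlast)
    have hef : e.q.length < f.q.length + f.s.length := (List.isChain_cons_cons.mp h).1
    have hf := length_s_le f
    set a := e.q.length - 2 with ha
    set b := f.q.length - 2 with hb
    -- One letter for the cell, `|a - b|` for the power of `gen 0`, and `n` for the tail. The bound
    -- needs `|a - b| + (a - b) ≤ 4`, which follows from `a ≤ b + 2`.
    refine ⟨1 + ((a : ℤ) - b).natAbs * 1 + n, by simp only [List.length_cons]; omega, ?_⟩
    have key := ((conj_stepValue e).mul (h₀.zpow ((a : ℤ) - b))).mul hw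
    rw [List.map_cons, List.prod_cons]
    convert key using 1
    rw [zpow_sub, zpow_natCast, zpow_natCast]
    simp only [← ha, mul_assoc, inv_mul_cancel_left]

/-- The first top word and the last bottom word have length 1, so the first and last cells have
empty right context. For the empty diagram the truncated bound is 0, as it should be. -/
theorem isWordOfLengthLE_mk (Δ : Diagram universalPresentation [XA.a] [XA.a]) :
    IsWordOfLengthLE gens (5 * Δ.numCells - 4) (DiagramGroup.mk Δ) := by
  obtain ⟨⟨l, hl⟩, rfl, hc⟩ := Diagram.exists_isChain Δ
  rw [mk_eq_prod]
  rcases l with _ | ⟨e, l⟩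
  · exact IsWordOfLengthLE.one _
  have hq : ∀ {p s q : List XA}, p ++ s ++ q = [XA.a] → s ≠ [] → q = [] := by
    intro p s q h hs
    have := congrArg List.length h
    have := List.length_pos_iff.mpr hs
    simp only [List.length_append, List.length_singleton] at *
    exact List.eq_nil_of_length_eq_zero (by omega)
  have hfirst : e.q = [] := hq hl.1.symm e.s_ne_nil
  have hlast : ((e :: l).getLast (by simp)).q = [] := by
    have hd := List.dropLast_append_getLast (l := e :: l) (by simp)
    rw [← hd] at hl
    obtain ⟨w, -, h⟩ := IsTwoPath.of_append hl
    exact hq h.2 (AtomicTwoPath.t_ne_nil _)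
  obtain ⟨n, hn, hw⟩ := isWordOfLengthLE_prod l e hc hlast
  have : 5 * (e :: l).length - 4 = 5 * l.length + 1 := by
    rw [List.length_cons]
    omega
  simp only [hfirst, List.length_nil, Nat.zero_sub, pow_zero, one_mul] at hn hw
  exact hw.mono (hn.trans this.ge)

theorem closure_gens : Subgroup.closure gens = ⊤ := by
  rw [eq_top_iff]
  rintro ⟨Δ⟩ -
  exact (isWordOfLengthLE_mk Δ).mem_closure

theorem hasPropertyB : HasPropertyB universalPresentation [XA.a] := by
  refine ⟨⟨⟨(Set.toFinite gens).toFinset, by simpa using closure_gens⟩⟩, fun S hS hgen => ?_⟩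
  have hword : ∀ g, IsWordOfLengthLE S (wordLength S g) g := fun g =>
    IsWordOfLengthLE.of_mem_closure (hgen ▸ Subgroup.mem_top g)
  constructor
  · obtain ⟨C, hC⟩ := (hS.image DiagramGroup.numCells).bddAbove
    refine ⟨C + 1, by positivity, fun g => ?_⟩
    have := DiagramGroup.numCells_le_of_isWordOfLengthLE
      (fun y hy => (hC (Set.mem_image_of_mem _ hy)).trans (Nat.le_succ C)) (hword g)
    beta_reduce
    exact_mod_cast this
  · obtain ⟨C, hC⟩ := ((Set.toFinite gens).image (wordLength S)).bddAbove
    -- `C` bounds the `S`-length of `x₀, x₁, x₂`; adding 1 keeps the constant positive.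
    refine ⟨(C + 1) * 5, by positivity, fun g => ?_⟩
    obtain ⟨Δ, rfl, hΔ⟩ := DiagramGroup.exists_numCells_eq g
    have := ((isWordOfLengthLE_mk Δ).trans (T := S) (C := C + 1) fun y hy =>
      (hword y).mono ((hC (Set.mem_image_of_mem _ hy)).trans (Nat.le_succ C))).wordLength_le
    rw [hΔ] at this
    have h' : wordLength S (DiagramGroup.mk Δ) ≤
        (C + 1) * 5 * DiagramGroup.numCells (DiagramGroup.mk Δ) := by
      rw [mul_assoc]
      exact this.trans (Nat.mul_le_mul_left _ (Nat.sub_le _ _))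
    beta_reduce
    exact_mod_cast h'

end UniversalDiagramGroup

theorem theorem3 :
    HasPropertyB universalPresentation [XA.a] ∧
    Subgroup.closure ({UniversalDiagramGroup.gen 0, UniversalDiagramGroup.gen 1,
      UniversalDiagramGroup.gen 2} : Set UniversalDiagramGroup) = ⊤ ∧
    ∀ (N : ℕ) (Δ : Diagram universalPresentation [XA.a] [XA.a]), Δ.numCells = N → 0 < N →
      wordLength ({UniversalDiagramGroup.gen 0, UniversalDiagramGroup.gen 1,
        UniversalDiagramGroup.gen 2} : Set UniversalDiagramGroup) (DiagramGroup.mk Δ) < 5 * N := by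
  refine ⟨UniversalDiagramGroup.hasPropertyB, UniversalDiagramGroup.closure_gens, ?_⟩
  rintro N Δ rfl hN
  exact (UniversalDiagramGroup.isWordOfLengthLE_mk Δ).wordLength_le.trans_lt (by omega)
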